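/- Let $n\ge 1$, let $h(x)=\sum_{k\ge 0}h_kx^k\in\mathbb{R}[[x]]$, and let $\mathcal H_n(h)=(h_{i+j})_{0\le i,j\le n-1}$ be its Hankel matrix of order $n$. Let $f_0,f_1\in\mathbb{R}[x]$ with $\deg f_0>\deg f_1$. The generalized Sturm sequence $f_0,f_1,\dots,f_s,f_{s+1}=0$ (with $f_0,\dots,f_s\ne 0$) is defined by $$f_i=B_if_{i+1}-f_{i+2},\qquad \deg f_{i+2}<\deg f_{i+1}\qquad (0\le i\le s-1),$$ that is, $-f_{i+2}$ is the remainder and $B_i$ the quotient in the division of $f_i$ by $f_{i+1}$. Let $m_i=\deg B_i$, let $b_i$ be the leading coefficient of $B_i$, and let $$S_{f_0,f_1}(x)=x^{m_0-1}\,\frac{\operatorname{Rv}f_1(x)}{\operatorname{Rv}f_0(x)}\in\mathbb{R}[[x]],\qquad m_0=\deg f_0-\deg f_1,\qquad \operatorname{Rv}f(x)=x^{\deg f}f(1/x),$$ with $\operatorname{Rv}0=0$, so that $S_{f_0,0}=0$. For $0\le k\le s+1$ and $c\in\mathbb{R}$ let $\mathcal V_k(c)$ be the number of sign changes, zeros being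 ignored, in $(f_0(c),f_1(c),\dots,f_k(c))$, and let $\mathcal V_k(\pm\infty)=\lim_{c\to\pm\infty}\mathcal V_k(c)$. Suppose that $\mathcal H_n(h)$ is nonsingular and that $S_{f_0,f_1}(x)\equiv h(x)\pmod{x^{2n-1}}$. Then there is an index $t$ with $0\le t\le s-1$ such that $\sum_{i=0}^{t}m_i=n$, the limits $\mathcal V_{t+1}(\pm\infty)$ exist, and the signature of $\mathcal H_n(h)$ (the number of positive minus the number of negative eigenvalues) is $$\mathcal V_{t+1}(-\infty)-\mathcal V_{t+1}(+\infty)=\sum_{\substack{0\le i\le t\\ m_i\text{ odd}}}\operatorname{sign}(b_i).$$ If $t=s-1$, then the limits $\mathcal V_{s+1}(\pm\infty)$ of the sign changes of the whole sequence $f_0,\dots,f_{s+1}$ exist and equal $\mathcal V_{t+1}(\pm\infty)$, so that here the signature is $\mathcal V(-\infty)-\mathcal V(+\infty)$ for the whole generalized Sturm sequence. -/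

import Mathlib

open Polynomial Filter Topology

noncomputable section

/-- The Hankel matrix `(h_{i+j})_{0 ≤ i, j ≤ n-1}` of order `n` of the power series
`h = h_0 + h_1 x + h_2 x² + ⋯`. -/
def hankelMatrix (n : ℕ) (h : PowerSeries ℝ) : Matrix (Fin n) (Fin n) ℝ :=
  Matrix.of fun i j => PowerSeries.coeff ((i : ℕ) + (j : ℕ)) h

/-- The signature of a real symmetric matrix: the positive index of inertia minus the negative
index of inertia of the quadratic form `v ↦ vᵀ A v`. -/
def matrixSignature {n : ℕ} (A : Matrix (Fin n) (Fin n) ℝ) : ℤ :=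
  (sigPos A.toQuadraticForm' : ℤ) - (sigNeg A.toQuadraticForm' : ℤ)

/-- The power series `S_{f₀,f₁} = x^{m₀-1} · Rv f₁ / Rv f₀` with `m₀ = deg f₀ - deg f₁`, where
`Rv f = x^{deg f} f(1/x)` is the reversal. The constant term of `Rv f₀` is the leading coefficient
of `f₀`, so for `f₀ ≠ 0` the inverse below is a genuine inverse of power series. -/
def sturmSeries (f₀ f₁ : ℝ[X]) : PowerSeries ℝ :=
  PowerSeries.X ^ (f₀.natDegree - f₁.natDegree - 1) *
    (f₁.reverse : PowerSeries ℝ) * (f₀.reverse : PowerSeries ℝ)⁻¹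

/-- The generalized Sturm sequence of `(f₀, f₁)`: `f_{i+2} = - rem(f_i, f_{i+1})` as long as
`f_{i+1} ≠ 0`; the sequence is continued by zeros after its first zero. -/
def sturmSeq (f₀ f₁ : ℝ[X]) : ℕ → ℝ[X]
  | 0 => f₀
  | 1 => f₁
  | i + 2 =>
    if sturmSeq f₀ f₁ (i + 1) = 0 then 0
    else -(sturmSeq f₀ f₁ i % sturmSeq f₀ f₁ (i + 1))

lemma sturmSeq_degree_lt (f₀ f₁ : ℝ[X]) (i : ℕ) (hi : sturmSeq f₀ f₁ (i + 1) ≠ 0) :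
    (sturmSeq f₀ f₁ (i + 2)).degree < (sturmSeq f₀ f₁ (i + 1)).degree := by
  rw [sturmSeq, if_neg hi, degree_neg]
  exact EuclideanDomain.mod_lt _ hi

lemma exists_sturmSeq_eq_zero (f₀ f₁ : ℝ[X]) : ∃ k, sturmSeq f₀ f₁ (k + 1) = 0 := by
  by_contra! hne
  have key : ∀ k, (sturmSeq f₀ f₁ (k + 1)).natDegree + k ≤ f₁.natDegree := by
    intro k
    induction k with
    | zero => simp [sturmSeq]
    | succ k ih =>
      have h := natDegree_lt_natDegree (hne (k + 1)) (sturmSeq_degree_lt f₀ f₁ k (hne k))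
      omega
  have h := key (f₁.natDegree + 1)
  omega

open Classical in
/-- The index `s` for which `f_{s+1} = 0` is the first vanishing term after `f₀`. -/
def sturmLength (f₀ f₁ : ℝ[X]) : ℕ := Nat.find (exists_sturmSeq_eq_zero f₀ f₁)

/-- The quotients `B_i`, for `0 ≤ i ≤ s - 1`, in `f_i = B_i f_{i+1} - f_{i+2}`. -/
def sturmQuot (f₀ f₁ : ℝ[X]) (i : ℕ) : ℝ[X] := sturmSeq f₀ f₁ i / sturmSeq f₀ f₁ (i + 1)

open Classical in
lemma sturmSeq_eq (f₀ f₁ : ℝ[X]) (i : ℕ) (hi : i < sturmLength f₀ f₁) :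
    sturmSeq f₀ f₁ i =
      sturmQuot f₀ f₁ i * sturmSeq f₀ f₁ (i + 1) - sturmSeq f₀ f₁ (i + 2) := by
  have h : sturmSeq f₀ f₁ (i + 1) ≠ 0 :=
    Nat.find_min (exists_sturmSeq_eq_zero f₀ f₁) hi
  have h2 : sturmSeq f₀ f₁ (i + 2) = -(sturmSeq f₀ f₁ i % sturmSeq f₀ f₁ (i + 1)) := by
    rw [sturmSeq, if_neg h]
  rw [h2, sturmQuot, sub_neg_eq_add, mul_comm, EuclideanDomain.div_add_mod]

/-- The number of sign changes in a finite sequence of real numbers, zeros being ignored: delete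
the zeros and count the pairs of neighbours of opposite sign. -/
def signChanges (l : List ℝ) : ℕ :=
  let l' := l.filter fun a => a ≠ 0
  (l'.zip l'.tail).countP fun p => p.1 * p.2 < 0

/-- The number `V(c)` of sign changes in `(f_0(c), f_1(c), …, f_k(c))`, where `f_0, f_1, …` is the
generalized Sturm sequence of `(f₀, f₁)`. -/
def sturmVar (f₀ f₁ : ℝ[X]) (k : ℕ) (c : ℝ) : ℕ :=
  signChanges ((List.range (k + 1)).map fun i => (sturmSeq f₀ f₁ i).eval c)

end

/-!
The coefficients `s_k` of `S_{f₀,f₁}` are those of the expansion `f₁ / f₀ = ∑ s_k x^{-k-1}`, so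
`s_k` is the residue (the coefficient of `x⁻¹`) of `x^k f₁ / f₀` (`coeff_sturmSeries`). Hence
`H_n(h)` is the Gram matrix of the form `(p, q) ↦ res (p q f₁ / f₀)` on the polynomials of degree
below `n`, in the basis of monomials (`dotProduct_hankelMatrix_mulVec`); only `s_0, …, s_{2n-2}`
matter.

Let `Q_k` be the denominators of the continued fraction of `f₁ / f₀` defined by the quotients
`B_i`. Then `deg Q_k = m_0 + ⋯ + m_{k-1}` and `Q_k f₁ ≡ f_{k+1}` modulo `f₀`
(`dvd_sturmDen_mul_sub`), where `deg f_{k+1} = deg f₀ - deg Q_{k+1}`. Thus `Q_k` is orthogonal to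
all `p` with `deg p < deg Q_{k+1} - 1`, and the value on `p` of degree `deg Q_{k+1} - 1` is read
off from leading coefficients (`polyMoment_mul_sturmDen_eq_zero`,
`polyMoment_mul_sturmDen_eq_div`). If `n` were not one of the degrees of the `Q_k`, the last `Q_k`
of degree below `n` would be in the kernel of `H_n(h)`; so `n = deg Q_{t+1}` for some `t`
(`exists_natDegree_sturmDen_eq`).

The polynomials `x^j Q_k` with `k ≤ t`, `j < m_k` form a basis in which the form is block
diagonal, and the block of `k` vanishes above the antidiagonal and has `1 / b_k` on it. Instead of
diagonalizing the blocks, one exhibits large semidefinite subspaces: the `x^j Q_k` with `2j + 1 <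
m_k` span a totally isotropic subspace, orthogonal to the middle vectors (`2j + 1 = m_k`) of the
blocks of odd size, which are orthogonal to each other and have the values `1 / b_k`
(`polyMoment_shiftedDen_mul`). Adding to the isotropic subspace the middle vectors with `b_k > 0`,
or those with `b_k < 0`, gives a nonnegative and a nonpositive subspace whose dimensions add up to
`n`. By Sylvester's law of inertia these dimensions are the two indices of inertia
(`matrixSignature_eq_card_sub_card`), and their difference is the sum of the signs of the `b_k`
with `m_k` odd.

Finally, near `±∞` the signs of `f_i f_{i+1}` and of `B_i` agree, so that `V_{t+1}(+∞)` counts the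
`i` with `b_i < 0` and `V_{t+1}(-∞)` those with `(-1)^{m_i} b_i < 0` (`eventually_sturmVar_eq`);
the difference of the two counts is the same sum of signs.
-/

/-! ### The residue functional of a quotient of polynomials -/

/-- The coefficient of `x⁻¹` in the expansion of `p / f` in powers of `x⁻¹`, as a linear functional
of `p`. It is computed from the remainder `r` of `p` modulo `f`: as `deg r < deg f`, only the
coefficient of `r` in degree `deg f - 1` contributes. For constant `f` the functional is zero. -/
noncomputable def polyResidue (f : ℝ[X]) : ℝ[X] →ₗ[ℝ] ℝ where
  toFun p := (p % f).coeff (f.natDegree - 1) / f.leadingCoeff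
  map_add' p q := by rw [Polynomial.add_mod, coeff_add, add_div]
  map_smul' c p := by
    have : (c • p) % f = c • (p % f) := by
      simp only [Polynomial.mod_def, Polynomial.smul_modByMonic]
    rw [this, coeff_smul, smul_eq_mul, mul_div_assoc, RingHom.id_apply, smul_eq_mul]

lemma polyResidue_of_degree_lt {f p : ℝ[X]} (h : p.degree < f.degree) :
    polyResidue f p = p.coeff (f.natDegree - 1) / f.leadingCoeff := by
  have hf : f ≠ 0 := by rintro rfl; simp at h
  change (p % f).coeff _ / _ = _
  rw [(mod_eq_self_iff hf).2 h]

lemma polyResidue_eq_of_dvd_sub {f p q : ℝ[X]} (h : f ∣ p - q) :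
    polyResidue f p = polyResidue f q := by
  rw [← sub_eq_zero, ← map_sub]
  change ((p - q) % f).coeff _ / _ = _
  rw [(EuclideanDomain.mod_eq_zero).2 h, coeff_zero, zero_div]

/-- One step of the expansion of `r / f` in powers of `x⁻¹`: the coefficient of `x⁻¹` is split off
and the rest is multiplied by `x`. Here the expansion is written as a power series in the inverse
variable, by means of `Polynomial.reflect`. -/
lemma reflect_mul_inv_eq {f r : ℝ[X]} (hr : r.degree < f.degree) (hf : 0 < f.natDegree) :
    ∃ r' : ℝ[X], r'.degree < f.degree ∧ f ∣ r' - X * r ∧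
      (reflect (f.natDegree - 1) r : PowerSeries ℝ) * (f.reverse : PowerSeries ℝ)⁻¹ =
        PowerSeries.C (r.coeff (f.natDegree - 1) / f.leadingCoeff) + PowerSeries.X *
          ((reflect (f.natDegree - 1) r' : PowerSeries ℝ) * (f.reverse : PowerSeries ℝ)⁻¹) := by
  have hf0 : f ≠ 0 := by rintro rfl; simp at hf
  have hlc : f.leadingCoeff ≠ 0 := leadingCoeff_ne_zero.2 hf0
  set a := r.coeff (f.natDegree - 1) / f.leadingCoeff with ha
  have hrN : r.natDegree < f.natDegree := by
    rcases eq_or_ne r 0 with rfl | h0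
    · simpa using hf
    · exact natDegree_lt_natDegree h0 hr
  have hcoeff : ∀ k, f.natDegree ≤ k → (X * r - C a * f).coeff k = 0 := by
    intro k hk
    obtain ⟨k, rfl⟩ : ∃ j, k = j + 1 := ⟨k - 1, by omega⟩
    rw [coeff_sub, coeff_X_mul, coeff_C_mul]
    rcases hk.eq_or_lt with h | h
    · rw [← h, coeff_natDegree, ha, h, Nat.add_sub_cancel, div_mul_cancel₀ _ hlc, sub_self]
    · rw [coeff_eq_zero_of_natDegree_lt h, coeff_eq_zero_of_natDegree_lt (by omega)]
      simp
  refine ⟨X * r - C a * f, ?_, ⟨-C a, by ring⟩, ?_⟩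
  · rw [degree_eq_natDegree hf0]
    exact (degree_lt_iff_coeff_zero _ _).2 hcoeff
  · have hrev : (f.reverse : PowerSeries ℝ).constantCoeff ≠ 0 := by
      rw [← PowerSeries.coeff_zero_eq_constantCoeff_apply, Polynomial.coeff_coe,
        coeff_zero_reverse]
      exact hlc
    -- The coefficients of `r = (C a * f + r') / X` in reversed order.
    have key : reflect (f.natDegree - 1) r =
        C a * f.reverse + X * reflect (f.natDegree - 1) (X * r - C a * f) := by
      ext k
      rw [coeff_add, coeff_C_mul, reverse, coeff_reflect, coeff_reflect]
      rcases k with _ | k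
      · simp [ha, div_mul_cancel₀ _ hlc]
      · rw [coeff_X_mul, coeff_reflect]
        rcases lt_or_ge k f.natDegree with hk | hk
        · rw [revAt_le (by omega : k + 1 ≤ f.natDegree), revAt_le (by omega : k ≤ f.natDegree - 1)]
          rcases lt_or_ge (k + 1) f.natDegree with hk' | hk'
          · rw [revAt_le (by omega : k + 1 ≤ f.natDegree - 1), coeff_sub, coeff_C_mul,
              show f.natDegree - 1 - k = (f.natDegree - 1 - (k + 1)) + 1 by omega, coeff_X_mul,
              show f.natDegree - (k + 1) = (f.natDegree - 1 - (k + 1)) + 1 by omega]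
            ring
          · rw [revAt_eq_self_of_lt (by omega : f.natDegree - 1 < k + 1),
              coeff_eq_zero_of_natDegree_lt (by omega), coeff_sub, coeff_C_mul,
              show f.natDegree - 1 - k = 0 by omega, show f.natDegree - (k + 1) = 0 by omega,
              coeff_X_mul_zero]
            ring
        · rw [revAt_eq_self_of_lt (by omega), revAt_eq_self_of_lt (by omega),
            revAt_eq_self_of_lt (by omega), coeff_eq_zero_of_natDegree_lt (by omega),
            coeff_eq_zero_of_natDegree_lt (by omega : f.natDegree < k + 1), hcoeff _ hk]
          ring
    conv_lhs => rw [key]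
    push_cast
    rw [add_mul, mul_assoc, PowerSeries.mul_inv_cancel _ hrev, mul_one, mul_assoc]

/-- The coefficients of the expansion of `r / f` in powers of `x⁻¹` are the residues of
`x ^ k * r / f`. -/
lemma coeff_reflect_mul_inv {f : ℝ[X]} (hf : 0 < f.natDegree) (k : ℕ) :
    ∀ r : ℝ[X], r.degree < f.degree →
      PowerSeries.coeff k ((reflect (f.natDegree - 1) r : PowerSeries ℝ) *
        (f.reverse : PowerSeries ℝ)⁻¹) = polyResidue f (X ^ k * r) := by
  induction k with
  | zero =>
    intro r hr
    obtain ⟨r', -, -, h⟩ := reflect_mul_inv_eq hr hf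
    rw [h, pow_zero, one_mul, polyResidue_of_degree_lt hr]
    simp
  | succ k ih =>
    intro r hr
    obtain ⟨r', hr', hdvd, h⟩ := reflect_mul_inv_eq hr hf
    rw [h, map_add, PowerSeries.coeff_succ_X_mul, ih r' hr', PowerSeries.coeff_C,
      if_neg (Nat.succ_ne_zero k), zero_add]
    refine polyResidue_eq_of_dvd_sub ((hdvd.mul_left (X ^ k)).trans (dvd_of_eq ?_))
    ring

/-- The coefficients of `S_{f₀,f₁}` are the residues of `x ^ k * f₁ / f₀`. -/
lemma coeff_sturmSeries {f₀ f₁ : ℝ[X]} (hdeg : f₁.degree < f₀.degree) (k : ℕ) :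
    PowerSeries.coeff k (sturmSeries f₀ f₁) = polyResidue f₀ (X ^ k * f₁) := by
  rcases eq_or_ne f₁ 0 with rfl | h1
  · simp [sturmSeries]
  have hN := natDegree_lt_natDegree h1 hdeg
  rw [← coeff_reflect_mul_inv (by omega) k f₁ hdeg, sturmSeries]
  have key : reflect (f₀.natDegree - 1) f₁ =
      X ^ (f₀.natDegree - f₁.natDegree - 1) * f₁.reverse := by
    have := reflect_mul (X ^ 0 : ℝ[X]) f₁ (F := f₀.natDegree - f₁.natDegree - 1) (by simp) le_rfl
    rw [reflect_monomial, revAt_le (Nat.zero_le _), pow_zero, one_mul, Nat.sub_zero] at this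
    rw [reverse, ← this]
    congr 1
    omega
  rw [key]
  push_cast
  rfl

/-- Multiplication by `g` followed by the residue functional of `f`. -/
noncomputable def polyMoment (f g : ℝ[X]) : ℝ[X] →ₗ[ℝ] ℝ :=
  polyResidue f ∘ₗ LinearMap.mulRight ℝ g

lemma polyMoment_apply (f g p : ℝ[X]) : polyMoment f g p = polyResidue f (p * g) := rfl

/-! ### Hankel matrices as moment forms -/

/-- The coefficients in degrees below `n`. -/
def coeffVec (n : ℕ) (p : ℝ[X]) : Fin n → ℝ := fun i => p.coeff i

lemma eq_sum_fin_monomial {n : ℕ} {p : ℝ[X]} (hp : p.degree < n) :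
    p = ∑ i : Fin n, p.coeff i • (X : ℝ[X]) ^ (i : ℕ) := by
  rw [Fin.sum_univ_eq_sum_range (fun i => p.coeff i • (X : ℝ[X]) ^ i)]
  ext k
  simp only [finsetSum_coeff, coeff_smul, coeff_X_pow, smul_eq_mul, mul_ite, mul_one, mul_zero,
    Finset.sum_ite_eq, Finset.mem_range]
  split_ifs with hk
  · rfl
  · exact coeff_eq_zero_of_degree_lt (hp.trans_le (by exact_mod_cast not_lt.1 hk))

/-- A Hankel matrix is the Gram matrix of the monomials for the form `(p, q) ↦ ψ (p * q)`, where
the linear functional `ψ` has the given moments. -/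
lemma dotProduct_hankelMatrix_mulVec {n : ℕ} {h : PowerSeries ℝ} {ψ : ℝ[X] →ₗ[ℝ] ℝ}
    (hψ : ∀ k < 2 * n - 1, ψ (X ^ k) = PowerSeries.coeff k h) {p q : ℝ[X]}
    (hp : p.degree < n) (hq : q.degree < n) :
    coeffVec n p ⬝ᵥ (hankelMatrix n h).mulVec (coeffVec n q) = ψ (p * q) := by
  conv_rhs => rw [eq_sum_fin_monomial hp, eq_sum_fin_monomial hq]
  rw [Finset.sum_mul_sum, map_sum]
  refine Finset.sum_congr rfl fun i _ => ?_
  rw [map_sum, Matrix.mulVec, dotProduct, Finset.mul_sum]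
  refine Finset.sum_congr rfl fun j _ => ?_
  rw [smul_mul_smul_comm, ← pow_add, map_smul, hψ _ (by omega), smul_eq_mul, coeffVec, coeffVec,
    hankelMatrix, Matrix.of_apply]
  ring

lemma exists_coeffVec_eq {n : ℕ} (v : Fin n → ℝ) : ∃ p : ℝ[X], p.degree < n ∧ coeffVec n p = v := by
  refine ⟨(degreeLTEquiv ℝ n).symm v, mem_degreeLT.1 (Subtype.property _), ?_⟩
  exact (degreeLTEquiv ℝ n).apply_symm_apply v

/-- A nonsingular Hankel matrix makes the moment form nondegenerate on polynomials of degree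
below `n`. -/
lemma eq_zero_of_moments_eq_zero {n : ℕ} {h : PowerSeries ℝ} (hH : (hankelMatrix n h).det ≠ 0)
    {ψ : ℝ[X] →ₗ[ℝ] ℝ} (hψ : ∀ k < 2 * n - 1, ψ (X ^ k) = PowerSeries.coeff k h) {q : ℝ[X]}
    (hq : q.degree < n) (h0 : ∀ p : ℝ[X], p.degree < n → ψ (p * q) = 0) : q = 0 := by
  have hv : coeffVec n q = 0 := by
    refine (Matrix.nondegenerate_of_det_ne_zero hH).eq_zero_of_ortho' fun w => ?_
    obtain ⟨p, hp, rfl⟩ := exists_coeffVec_eq w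
    rw [dotProduct_hankelMatrix_mulVec hψ hp hq, h0 p hp]
  rw [eq_sum_fin_monomial hq]
  refine Finset.sum_eq_zero fun i _ => ?_
  rw [show q.coeff i = 0 from congrFun hv i, zero_smul]

lemma hankelMatrix_isSymm (n : ℕ) (h : PowerSeries ℝ) : (hankelMatrix n h).IsSymm := by
  ext i j
  simp [hankelMatrix, Nat.add_comm]

/-! ### Signatures from semidefinite subspaces -/

lemma toQuadraticForm'_eq {n : ℕ} (A : Matrix (Fin n) (Fin n) ℝ) (v : Fin n → ℝ) :
    A.toQuadraticForm' v = v ⬝ᵥ A.mulVec v := by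
  simp [Matrix.toQuadraticForm', Matrix.toLinearMap₂'_apply']

lemma sigPos_add_sigNeg_of_det_ne_zero {n : ℕ} {A : Matrix (Fin n) (Fin n) ℝ} (hA : A.IsSymm)
    (hdet : A.det ≠ 0) : sigPos A.toQuadraticForm' + sigNeg A.toQuadraticForm' = n := by
  have hrad : A.toQuadraticForm'.radical = ⊥ := by
    rw [eq_bot_iff]
    intro v hv
    rw [QuadraticMap.mem_radical_iff'] at hv
    refine (Matrix.nondegenerate_of_det_ne_zero hdet).eq_zero_of_ortho fun w => ?_
    have h1 := hv.2 w
    have hsymm : w ⬝ᵥ A.mulVec v = v ⬝ᵥ A.mulVec w := by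
      rw [Matrix.dotProduct_mulVec, ← Matrix.mulVec_transpose, hA.eq, dotProduct_comm]
    have h2 := hv.1
    rw [toQuadraticForm'_eq] at h2
    rw [toQuadraticForm'_eq, toQuadraticForm'_eq, Matrix.mulVec_add, add_dotProduct,
      dotProduct_add, dotProduct_add, hsymm, h2] at h1
    linarith
  have := QuadraticForm.sigPos_add_sigNeg_add_radical (Q := A.toQuadraticForm')
  rwa [hrad, finrank_bot, add_zero, Module.finrank_fin_fun] at this

/-- A form whose Gram matrix on a family is diagonal with nonnegative entries is nonnegative on
the span of the family. -/
lemma dotProduct_mulVec_nonneg_of_mem_span {n : ℕ} (A : Matrix (Fin n) (Fin n) ℝ) {ι : Type*}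
    {e : ι → Fin n → ℝ} (hoff : ∀ i j, i ≠ j → e i ⬝ᵥ A.mulVec (e j) = 0)
    (hdiag : ∀ i, 0 ≤ e i ⬝ᵥ A.mulVec (e i)) {v : Fin n → ℝ}
    (hv : v ∈ Submodule.span ℝ (Set.range e)) : 0 ≤ v ⬝ᵥ A.mulVec v := by
  classical
  obtain ⟨c, rfl⟩ := Finsupp.mem_span_range_iff_exists_finsupp.1 hv
  rw [Finsupp.sum, Matrix.mulVec_sum, sum_dotProduct]
  refine Finset.sum_nonneg fun i hi => ?_
  rw [dotProduct_sum, Finset.sum_eq_single_of_mem i hi]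
  · rw [Matrix.mulVec_smul, smul_dotProduct, dotProduct_smul, smul_smul]
    exact mul_nonneg (mul_self_nonneg _) (hdiag i)
  · intro j _ hj
    rw [Matrix.mulVec_smul, smul_dotProduct, dotProduct_smul, hoff i j hj.symm, smul_zero,
      smul_zero]

lemma sigNeg_add_card_le {n : ℕ} (A : Matrix (Fin n) (Fin n) ℝ) {ι : Type*} [Fintype ι]
    {e : ι → Fin n → ℝ} (he : LinearIndependent ℝ e)
    (hoff : ∀ i j, i ≠ j → e i ⬝ᵥ A.mulVec (e j) = 0)
    (hdiag : ∀ i, 0 ≤ e i ⬝ᵥ A.mulVec (e i)) :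
    sigNeg A.toQuadraticForm' + Fintype.card ι ≤ n := by
  have := QuadraticForm.sigPos_add_finrank_le_of_nonpos (Q := -A.toQuadraticForm')
    (V := Submodule.span ℝ (Set.range e)) fun x hx => by
      rw [_root_.neg_apply, toQuadraticForm'_eq, neg_nonpos]
      exact dotProduct_mulVec_nonneg_of_mem_span A hoff hdiag hx
  rwa [sigPos_neg, finrank_span_eq_card he, Module.finrank_fin_fun] at this

lemma sigPos_add_card_le {n : ℕ} (A : Matrix (Fin n) (Fin n) ℝ) {ι : Type*} [Fintype ι]
    {e : ι → Fin n → ℝ} (he : LinearIndependent ℝ e)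
    (hoff : ∀ i j, i ≠ j → e i ⬝ᵥ A.mulVec (e j) = 0)
    (hdiag : ∀ i, e i ⬝ᵥ A.mulVec (e i) ≤ 0) :
    sigPos A.toQuadraticForm' + Fintype.card ι ≤ n := by
  have := QuadraticForm.sigPos_add_finrank_le_of_nonpos (Q := A.toQuadraticForm')
    (V := Submodule.span ℝ (Set.range e)) fun x hx => by
      rw [toQuadraticForm'_eq, ← neg_nonneg, ← dotProduct_neg, ← Matrix.neg_mulVec]
      refine dotProduct_mulVec_nonneg_of_mem_span (-A) (fun i j hij => ?_) (fun i => ?_) hx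
      · rw [Matrix.neg_mulVec, dotProduct_neg, hoff i j hij, neg_zero]
      · rw [Matrix.neg_mulVec, dotProduct_neg, neg_nonneg]
        exact hdiag i
  rwa [finrank_span_eq_card he, Module.finrank_fin_fun] at this

/-- If the Gram matrix of an independent family `e` is diagonal on the index set `P` with
nonnegative entries, diagonal on `N` with nonpositive entries, and `|P| + |N| = n`, then a
nondegenerate form in `n` variables has signature `|P| - |N|`. The sets may overlap: on the common
part the form is totally isotropic. -/
lemma matrixSignature_eq_card_sub_card {n : ℕ} {A : Matrix (Fin n) (Fin n) ℝ} (hA : A.IsSymm)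
    (hdet : A.det ≠ 0) {ι : Type*} {e : ι → Fin n → ℝ} {P N : Finset ι}
    (hP : LinearIndependent ℝ fun i : P => e i) (hN : LinearIndependent ℝ fun i : N => e i)
    (hcard : P.card + N.card = n)
    (hPoff : ∀ i ∈ P, ∀ j ∈ P, i ≠ j → e i ⬝ᵥ A.mulVec (e j) = 0)
    (hNoff : ∀ i ∈ N, ∀ j ∈ N, i ≠ j → e i ⬝ᵥ A.mulVec (e j) = 0)
    (hPdiag : ∀ i ∈ P, 0 ≤ e i ⬝ᵥ A.mulVec (e i))
    (hNdiag : ∀ i ∈ N, e i ⬝ᵥ A.mulVec (e i) ≤ 0) :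
    matrixSignature A = (P.card : ℤ) - (N.card : ℤ) := by
  have h1 := sigNeg_add_card_le A hP
    (fun i j hij => hPoff i i.2 j j.2 fun h => hij (Subtype.ext h)) fun i => hPdiag i i.2
  have h2 := sigPos_add_card_le A hN
    (fun i j hij => hNoff i i.2 j j.2 fun h => hij (Subtype.ext h)) fun i => hNdiag i i.2
  have h3 := sigPos_add_sigNeg_of_det_ne_zero hA hdet
  rw [Fintype.card_coe] at h1 h2
  rw [matrixSignature]
  omega

lemma linearIndependent_of_natDegree_injective {ι : Type*} {p : ι → ℝ[X]} (h0 : ∀ i, p i ≠ 0)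
    (hinj : Function.Injective fun i => (p i).natDegree) : LinearIndependent ℝ p := by
  refine linearIndependent_iff'.2 fun s g hg i hi => ?_
  by_contra hgi
  have hdeg := degree_sum_eq_of_disjoint (fun i => g i • p i) s ?_
  · rw [hg, degree_zero, eq_comm, Finset.sup_eq_bot_iff] at hdeg
    exact smul_ne_zero hgi (h0 i) (degree_eq_bot.1 (hdeg i hi))
  · rintro a ⟨-, ha⟩ b ⟨-, hb⟩ hab heq
    have ha' : g a ≠ 0 := left_ne_zero_of_smul ha
    have hb' : g b ≠ 0 := left_ne_zero_of_smul hb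
    refine hab (hinj ?_)
    simp only [Function.comp_apply, smul_eq_C_mul, degree_C_mul ha', degree_C_mul hb'] at heq
    exact natDegree_eq_of_degree_eq heq

lemma linearIndependent_coeffVec {ι : Type*} {n : ℕ} {p : ι → ℝ[X]} (hp : ∀ i, (p i).degree < n)
    (h : LinearIndependent ℝ p) : LinearIndependent ℝ fun i => coeffVec n (p i) := by
  have h' : LinearIndependent ℝ fun i => (⟨p i, mem_degreeLT.2 (hp i)⟩ : degreeLT ℝ n) :=
    LinearIndependent.of_comp (Submodule.subtype _) h
  exact h'.map' (degreeLTEquiv ℝ n).toLinearMap (LinearEquiv.ker _)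

/-! ### The generalized Sturm sequence and its denominators -/

section Sturm

variable {f₀ f₁ : ℝ[X]}

lemma sturmSeq_sturmLength_succ (f₀ f₁ : ℝ[X]) :
    sturmSeq f₀ f₁ (sturmLength f₀ f₁ + 1) = 0 := by
  classical
  exact Nat.find_spec (exists_sturmSeq_eq_zero f₀ f₁)

lemma sturmSeq_ne_zero (hdeg : f₁.degree < f₀.degree) {k : ℕ} (hk : k ≤ sturmLength f₀ f₁) :
    sturmSeq f₀ f₁ k ≠ 0 := by
  classical
  rcases k with _ | k
  · rw [sturmSeq]
    rintro rfl
    simp at hdeg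
  · exact Nat.find_min (exists_sturmSeq_eq_zero f₀ f₁) hk

lemma degree_sturmSeq_succ_lt (hdeg : f₁.degree < f₀.degree) {k : ℕ}
    (hk : k ≤ sturmLength f₀ f₁) :
    (sturmSeq f₀ f₁ (k + 1)).degree < (sturmSeq f₀ f₁ k).degree := by
  rcases k with _ | k
  · simpa [sturmSeq] using hdeg
  · exact sturmSeq_degree_lt f₀ f₁ k (sturmSeq_ne_zero hdeg hk)

lemma sturmQuot_ne_zero (hdeg : f₁.degree < f₀.degree) {k : ℕ} (hk : k < sturmLength f₀ f₁) :
    sturmQuot f₀ f₁ k ≠ 0 := by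
  rw [sturmQuot, Ne, Polynomial.div_eq_zero_iff (sturmSeq_ne_zero hdeg hk)]
  exact (degree_sturmSeq_succ_lt hdeg hk.le).not_gt

lemma natDegree_sturmQuot_add (hdeg : f₁.degree < f₀.degree) {k : ℕ}
    (hk : k < sturmLength f₀ f₁) :
    (sturmQuot f₀ f₁ k).natDegree + (sturmSeq f₀ f₁ (k + 1)).natDegree =
      (sturmSeq f₀ f₁ k).natDegree := by
  have h0 := sturmSeq_ne_zero hdeg hk
  have h := degree_add_div h0 (degree_sturmSeq_succ_lt hdeg hk.le).le
  rw [← degree_mul] at h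
  rw [add_comm, ← natDegree_mul h0 (sturmQuot_ne_zero hdeg hk)]
  exact natDegree_eq_of_degree_eq h

lemma natDegree_sturmQuot_pos (hdeg : f₁.degree < f₀.degree) {k : ℕ}
    (hk : k < sturmLength f₀ f₁) : 0 < (sturmQuot f₀ f₁ k).natDegree := by
  have h1 := natDegree_sturmQuot_add hdeg hk
  have h2 := natDegree_lt_natDegree (sturmSeq_ne_zero hdeg (k := k + 1) hk)
    (degree_sturmSeq_succ_lt hdeg hk.le)
  omega

lemma leadingCoeff_sturmQuot_mul (hdeg : f₁.degree < f₀.degree) {k : ℕ}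
    (hk : k < sturmLength f₀ f₁) :
    (sturmQuot f₀ f₁ k).leadingCoeff * (sturmSeq f₀ f₁ (k + 1)).leadingCoeff =
      (sturmSeq f₀ f₁ k).leadingCoeff := by
  have h0 := sturmSeq_ne_zero hdeg hk
  rw [sturmQuot, leadingCoeff_div (degree_sturmSeq_succ_lt hdeg hk.le).le,
    div_mul_cancel₀ _ (leadingCoeff_ne_zero.2 h0)]

/-- The denominators `Q_k` of the convergents of the continued fraction
`f₁ / f₀ = 1 / (B_0 - 1 / (B_1 - ⋯))`. -/
noncomputable def sturmDen (f₀ f₁ : ℝ[X]) : ℕ → ℝ[X]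
  | 0 => 1
  | 1 => sturmQuot f₀ f₁ 0
  | k + 2 => sturmQuot f₀ f₁ (k + 1) * sturmDen f₀ f₁ (k + 1) - sturmDen f₀ f₁ k

/-- The convergents approximate `f₁ / f₀`: modulo `f₀`, the product `Q_k f₁` is the much smaller
polynomial `f_{k+1}`. -/
lemma dvd_sturmDen_mul_sub (f₀ f₁ : ℝ[X]) (k : ℕ) (hk : k ≤ sturmLength f₀ f₁) :
    f₀ ∣ sturmDen f₀ f₁ k * f₁ - sturmSeq f₀ f₁ (k + 1) := by
  induction k using Nat.strong_induction_on with
  | _ k ih =>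
    match k with
    | 0 => simp [sturmDen, sturmSeq]
    | 1 =>
      have h : f₀ = sturmQuot f₀ f₁ 0 * f₁ - sturmSeq f₀ f₁ 2 := sturmSeq_eq f₀ f₁ 0 hk
      exact dvd_of_eq h
    | k + 2 =>
      have h := sturmSeq_eq f₀ f₁ (k + 1) hk
      obtain ⟨a, ha⟩ := ih k (by omega) (by omega)
      obtain ⟨b, hb⟩ := ih (k + 1) (by omega) (by omega)
      refine ⟨sturmQuot f₀ f₁ (k + 1) * b - a, ?_⟩
      rw [sturmDen]
      linear_combination sturmQuot f₀ f₁ (k + 1) * hb - ha - h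

lemma degree_lt_sturmQuot_mul (hdeg : f₁.degree < f₀.degree) {k : ℕ}
    (hk : k < sturmLength f₀ f₁) {q : ℝ[X]} (hq : q ≠ 0) :
    q.degree < (sturmQuot f₀ f₁ k * q).degree := by
  have hpos := natDegree_sturmQuot_pos hdeg hk
  have hB := sturmQuot_ne_zero hdeg hk
  rw [degree_eq_natDegree hq, degree_eq_natDegree (mul_ne_zero hB hq), natDegree_mul hB hq]
  exact_mod_cast (by omega)

/-- As the quotients are not constant, the leading term of `Q_{k+1}` is that of `B_k Q_k`. -/
lemma sturmDen_succ_leading (hdeg : f₁.degree < f₀.degree) (k : ℕ)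
    (hk : k < sturmLength f₀ f₁) :
    (sturmDen f₀ f₁ k).degree < (sturmDen f₀ f₁ (k + 1)).degree ∧
      (sturmDen f₀ f₁ (k + 1)).natDegree =
        (sturmQuot f₀ f₁ k).natDegree + (sturmDen f₀ f₁ k).natDegree ∧
      (sturmDen f₀ f₁ (k + 1)).leadingCoeff =
        (sturmQuot f₀ f₁ k).leadingCoeff * (sturmDen f₀ f₁ k).leadingCoeff := by
  induction k with
  | zero =>
    have h := degree_lt_sturmQuot_mul hdeg hk one_ne_zero
    rw [mul_one] at h
    simpa [sturmDen] using h
  | succ k ih =>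
    have h1 := (ih (by omega)).1
    have hQ : sturmDen f₀ f₁ (k + 1) ≠ 0 := ne_zero_of_degree_gt h1
    have hlt := degree_lt_sturmQuot_mul hdeg hk hQ
    have h2 := h1.trans hlt
    rw [sturmDen]
    refine ⟨?_, ?_, ?_⟩
    · rwa [degree_sub_eq_left_of_degree_lt h2]
    · rw [natDegree_eq_of_degree_eq (degree_sub_eq_left_of_degree_lt h2),
        natDegree_mul (sturmQuot_ne_zero hdeg hk) hQ]
    · rw [leadingCoeff_sub_of_degree_lt h2, leadingCoeff_mul]

lemma sturmDen_ne_zero (hdeg : f₁.degree < f₀.degree) {k : ℕ} (hk : k ≤ sturmLength f₀ f₁) :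
    sturmDen f₀ f₁ k ≠ 0 := by
  rcases k with _ | k
  · simp [sturmDen]
  · exact ne_zero_of_degree_gt (sturmDen_succ_leading hdeg k hk).1

lemma natDegree_sturmDen (hdeg : f₁.degree < f₀.degree) (k : ℕ) (hk : k ≤ sturmLength f₀ f₁) :
    (sturmDen f₀ f₁ k).natDegree = ∑ i ∈ Finset.range k, (sturmQuot f₀ f₁ i).natDegree := by
  induction k with
  | zero => simp [sturmDen]
  | succ k ih =>
    rw [(sturmDen_succ_leading hdeg k hk).2.1, ih (by omega), Finset.sum_range_succ, add_comm]

lemma natDegree_sturmDen_add (hdeg : f₁.degree < f₀.degree) (k : ℕ)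
    (hk : k ≤ sturmLength f₀ f₁) :
    (sturmDen f₀ f₁ k).natDegree + (sturmSeq f₀ f₁ k).natDegree = f₀.natDegree := by
  induction k with
  | zero => simp [sturmDen, sturmSeq]
  | succ k ih =>
    rw [← ih (by omega), (sturmDen_succ_leading hdeg k hk).2.1, ← natDegree_sturmQuot_add hdeg hk]
    ring

lemma leadingCoeff_sturmDen_mul (hdeg : f₁.degree < f₀.degree) (k : ℕ)
    (hk : k ≤ sturmLength f₀ f₁) :
    (sturmDen f₀ f₁ k).leadingCoeff * (sturmSeq f₀ f₁ k).leadingCoeff = f₀.leadingCoeff := by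
  induction k with
  | zero => simp [sturmDen, sturmSeq]
  | succ k ih =>
    rw [← ih (by omega), (sturmDen_succ_leading hdeg k hk).2.2,
      ← leadingCoeff_sturmQuot_mul hdeg hk]
    ring

lemma polyMoment_mul_sturmDen {k : ℕ} (hk : k ≤ sturmLength f₀ f₁) {p : ℝ[X]}
    (hp : (p * sturmSeq f₀ f₁ (k + 1)).degree < f₀.degree) :
    polyMoment f₀ f₁ (p * sturmDen f₀ f₁ k) =
      (p * sturmSeq f₀ f₁ (k + 1)).coeff (f₀.natDegree - 1) / f₀.leadingCoeff := by
  rw [polyMoment_apply, ← polyResidue_of_degree_lt hp]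
  refine polyResidue_eq_of_dvd_sub (((dvd_sturmDen_mul_sub f₀ f₁ k hk).mul_left p).trans ?_)
  exact dvd_of_eq (by ring)

lemma polyMoment_mul_sturmDen_eq_zero_of_sturmSeq_eq_zero {k : ℕ} (hk : k ≤ sturmLength f₀ f₁)
    (hdeg : f₁.degree < f₀.degree) (h0 : sturmSeq f₀ f₁ (k + 1) = 0) (p : ℝ[X]) :
    polyMoment f₀ f₁ (p * sturmDen f₀ f₁ k) = 0 := by
  rw [polyMoment_mul_sturmDen hk] <;> simp [h0, bot_lt_of_lt hdeg]

/-- Orthogonality of the denominators: `Q_k` is orthogonal to all polynomials of degree less than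
`deg Q_{k+1} - 1`. -/
lemma polyMoment_mul_sturmDen_eq_zero (hdeg : f₁.degree < f₀.degree) {k : ℕ}
    (hk : k < sturmLength f₀ f₁) {p : ℝ[X]}
    (hp : p.natDegree + 1 < (sturmDen f₀ f₁ (k + 1)).natDegree) :
    polyMoment f₀ f₁ (p * sturmDen f₀ f₁ k) = 0 := by
  have h1 := natDegree_sturmDen_add hdeg (k + 1) hk
  have h2 : (p * sturmSeq f₀ f₁ (k + 1)).natDegree < f₀.natDegree - 1 :=
    natDegree_mul_le.trans_lt (by omega)
  rw [polyMoment_mul_sturmDen hk.le, coeff_eq_zero_of_natDegree_lt h2, zero_div]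
  exact degree_lt_degree (by omega)

/-- The first nonzero pairings of `Q_k`, those with polynomials of degree `deg Q_{k+1} - 1`. -/
lemma polyMoment_mul_sturmDen_eq_div (hdeg : f₁.degree < f₀.degree) {k : ℕ}
    (hk : k < sturmLength f₀ f₁) {p : ℝ[X]}
    (hp : p.natDegree + 1 = (sturmDen f₀ f₁ (k + 1)).natDegree) :
    polyMoment f₀ f₁ (p * sturmDen f₀ f₁ k) =
      p.leadingCoeff / (sturmDen f₀ f₁ (k + 1)).leadingCoeff := by
  have h1 := natDegree_sturmDen_add hdeg (k + 1) hk
  have h2 := leadingCoeff_sturmDen_mul hdeg (k + 1) hk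
  have h3 := leadingCoeff_ne_zero.2 (sturmSeq_ne_zero hdeg hk)
  rw [polyMoment_mul_sturmDen hk.le, ← h1, ← h2,
    show (sturmDen f₀ f₁ (k + 1)).natDegree + (sturmSeq f₀ f₁ (k + 1)).natDegree - 1 =
      p.natDegree + (sturmSeq f₀ f₁ (k + 1)).natDegree by omega,
    coeff_mul_degree_add_degree, mul_div_mul_right _ _ h3]
  refine degree_lt_degree (natDegree_mul_le.trans_lt (by omega))

/-- Nonsingularity of the Hankel matrix forces its order to be the degree of one of the
denominators: otherwise the last denominator of degree below `n` would be orthogonal to all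
polynomials of degree below `n`. -/
lemma exists_natDegree_sturmDen_eq {n : ℕ} (hn : 1 ≤ n) {h : PowerSeries ℝ}
    (hdeg : f₁.degree < f₀.degree) (hH : (hankelMatrix n h).det ≠ 0)
    (hψ : ∀ k < 2 * n - 1, polyMoment f₀ f₁ (X ^ k) = PowerSeries.coeff k h) :
    ∃ t < sturmLength f₀ f₁, (sturmDen f₀ f₁ (t + 1)).natDegree = n := by
  classical
  by_contra! hne
  -- No degree equals `n`, and none can jump over `n`: if `deg Q_k < n < deg Q_{k+1}`, then `Q_k` is
  -- orthogonal to all polynomials of degree below `n`.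
  have hlt : ∀ k ≤ sturmLength f₀ f₁, (sturmDen f₀ f₁ k).natDegree < n := by
    intro k
    induction k with
    | zero => intro _; simpa [sturmDen] using Nat.lt_of_succ_le hn
    | succ k ih =>
      intro hk
      refine lt_of_le_of_ne (not_lt.1 fun hgt => ?_) (hne k hk)
      refine sturmDen_ne_zero hdeg (Nat.le_of_succ_le hk) (eq_zero_of_moments_eq_zero hH hψ ?_ ?_)
      · exact natDegree_lt_iff_degree_lt (sturmDen_ne_zero hdeg (Nat.le_of_succ_le hk)) |>.1
          (ih (by omega))
      · intro p hp
        refine polyMoment_mul_sturmDen_eq_zero hdeg hk ?_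
        have : p.natDegree < n := by
          rcases eq_or_ne p 0 with rfl | h0
          · simpa using Nat.lt_of_succ_le hn
          · exact (natDegree_lt_iff_degree_lt h0).2 hp
        omega
  -- If all the denominators have degree below `n`, then so does `Q_s`, and it is orthogonal to
  -- everything, because `f_{s+1} = 0`.
  refine sturmDen_ne_zero hdeg le_rfl (eq_zero_of_moments_eq_zero hH hψ ?_ fun p _ => ?_)
  · exact (natDegree_lt_iff_degree_lt (sturmDen_ne_zero hdeg le_rfl)).1 (hlt _ le_rfl)
  · exact polyMoment_mul_sturmDen_eq_zero_of_sturmSeq_eq_zero le_rfl hdeg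
      (sturmSeq_sturmLength_succ f₀ f₁) p

/-! ### The signature of the Hankel matrix -/

/-- The shifted denominators `x ^ j * Q_k`, indexed by the pairs `(k, j)`. -/
noncomputable def shiftedDen (f₀ f₁ : ℝ[X]) (a : (_ : ℕ) × ℕ) : ℝ[X] :=
  X ^ a.2 * sturmDen f₀ f₁ a.1

/-- The indices `(k, j)`, `k ≤ t`, of the shifted denominators `x ^ j * Q_k` that span the isotropic
part (`2 j + 1 < m_k`), together with the middle ones (`2 j + 1 = m_k`) for which `b_k` has the
sign selected by `S`. -/
noncomputable def semidefIndex (f₀ f₁ : ℝ[X]) (t : ℕ) (S : ℝ → Prop) [DecidablePred S] :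
    Finset ((_ : ℕ) × ℕ) :=
  (Finset.range (t + 1)).sigma fun k => (Finset.range (sturmQuot f₀ f₁ k).natDegree).filter fun j =>
    2 * j + 1 < (sturmQuot f₀ f₁ k).natDegree ∨
      (2 * j + 1 = (sturmQuot f₀ f₁ k).natDegree ∧ S (sturmQuot f₀ f₁ k).leadingCoeff)

lemma mem_semidefIndex {t : ℕ} {S : ℝ → Prop} [DecidablePred S] {a : (_ : ℕ) × ℕ} :
    a ∈ semidefIndex f₀ f₁ t S ↔ a.1 ≤ t ∧ (2 * a.2 + 1 < (sturmQuot f₀ f₁ a.1).natDegree ∨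
      (2 * a.2 + 1 = (sturmQuot f₀ f₁ a.1).natDegree ∧
        S (sturmQuot f₀ f₁ a.1).leadingCoeff)) := by
  rw [semidefIndex, Finset.mem_sigma, Finset.mem_filter, Finset.mem_range, Finset.mem_range,
    Nat.lt_succ_iff]
  constructor
  · exact fun h => ⟨h.1, h.2.2⟩
  · exact fun h => ⟨h.1, by omega, h.2⟩

lemma card_semidefIndex (f₀ f₁ : ℝ[X]) (t : ℕ) (S : ℝ → Prop) [DecidablePred S] :
    (semidefIndex f₀ f₁ t S).card = ∑ k ∈ Finset.range (t + 1),
      ((sturmQuot f₀ f₁ k).natDegree / 2 +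
        if Odd (sturmQuot f₀ f₁ k).natDegree ∧ S (sturmQuot f₀ f₁ k).leadingCoeff
          then 1 else 0) := by
  rw [semidefIndex, Finset.card_sigma]
  refine Finset.sum_congr rfl fun k _ => ?_
  generalize (sturmQuot f₀ f₁ k).natDegree = m
  generalize (sturmQuot f₀ f₁ k).leadingCoeff = b
  rw [← Finset.card_range (m / 2 + _)]
  congr 1
  ext j
  simp only [Finset.mem_filter, Finset.mem_range, Nat.odd_iff]
  split_ifs with h
  · have := h.2
    simp only [this, and_true]
    omega
  · rw [not_and] at h
    constructor
    · rintro ⟨hj, h1 | ⟨h1, h2⟩⟩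
      · omega
      · exact absurd h2 (h (by omega))
    · intro hj
      exact ⟨by omega, Or.inl (by omega)⟩

lemma natDegree_shiftedDen (hdeg : f₁.degree < f₀.degree) {a : (_ : ℕ) × ℕ}
    (ha : a.1 ≤ sturmLength f₀ f₁) :
    (shiftedDen f₀ f₁ a).natDegree = a.2 + (sturmDen f₀ f₁ a.1).natDegree := by
  rw [shiftedDen, natDegree_mul (pow_ne_zero _ X_ne_zero) (sturmDen_ne_zero hdeg ha),
    natDegree_X_pow]

lemma natDegree_sturmDen_mono (hdeg : f₁.degree < f₀.degree) {k l : ℕ} (hkl : k ≤ l)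
    (hl : l ≤ sturmLength f₀ f₁) :
    (sturmDen f₀ f₁ k).natDegree ≤ (sturmDen f₀ f₁ l).natDegree := by
  rw [natDegree_sturmDen hdeg _ hl, natDegree_sturmDen hdeg _ (hkl.trans hl)]
  exact Finset.sum_le_sum_of_subset (Finset.range_mono hkl)

lemma shiftedDen_ne_zero (hdeg : f₁.degree < f₀.degree) {a : (_ : ℕ) × ℕ}
    (ha : a.1 ≤ sturmLength f₀ f₁) : shiftedDen f₀ f₁ a ≠ 0 :=
  mul_ne_zero (pow_ne_zero _ X_ne_zero) (sturmDen_ne_zero hdeg ha)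

lemma natDegree_shiftedDen_lt (hdeg : f₁.degree < f₀.degree) {t : ℕ}
    (ht : t < sturmLength f₀ f₁) {S : ℝ → Prop} [DecidablePred S] {a : (_ : ℕ) × ℕ}
    (ha : a ∈ semidefIndex f₀ f₁ t S) :
    (shiftedDen f₀ f₁ a).natDegree < (sturmDen f₀ f₁ (a.1 + 1)).natDegree := by
  obtain ⟨h1, h2⟩ := mem_semidefIndex.1 ha
  have h3 := natDegree_shiftedDen hdeg (show a.1 ≤ sturmLength f₀ f₁ by omega)
  have h4 := (sturmDen_succ_leading hdeg a.1 (by omega)).2.1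
  omega

lemma degree_shiftedDen_lt (hdeg : f₁.degree < f₀.degree) {t : ℕ}
    (ht : t < sturmLength f₀ f₁) {S : ℝ → Prop} [DecidablePred S] {a : (_ : ℕ) × ℕ}
    (ha : a ∈ semidefIndex f₀ f₁ t S) :
    (shiftedDen f₀ f₁ a).degree < (sturmDen f₀ f₁ (t + 1)).natDegree := by
  have h1 := (mem_semidefIndex.1 ha).1
  have h2 := natDegree_shiftedDen_lt hdeg ht ha
  have h3 := natDegree_sturmDen_mono hdeg (show a.1 + 1 ≤ t + 1 by omega) ht
  exact (natDegree_lt_iff_degree_lt (shiftedDen_ne_zero hdeg (by omega))).1 (by omega)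

/-- On the chosen index set the shifted denominators are orthogonal; all are isotropic except the
middle ones, on which the form takes the value `1 / b_k`. -/
lemma polyMoment_shiftedDen_mul (hdeg : f₁.degree < f₀.degree) {t : ℕ}
    (ht : t < sturmLength f₀ f₁) {S : ℝ → Prop} [DecidablePred S] {a b : (_ : ℕ) × ℕ}
    (ha : a ∈ semidefIndex f₀ f₁ t S) (hb : b ∈ semidefIndex f₀ f₁ t S) :
    polyMoment f₀ f₁ (shiftedDen f₀ f₁ a * shiftedDen f₀ f₁ b) =
      if a = b ∧ 2 * a.2 + 1 = (sturmQuot f₀ f₁ a.1).natDegree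
        then (sturmQuot f₀ f₁ a.1).leadingCoeff⁻¹ else 0 := by
  -- The form is symmetric, so the denominator with the larger index may be placed last, where the
  -- orthogonality relations apply to it.
  wlog hab : a.1 ≤ b.1 generalizing a b
  · rw [mul_comm, this hb ha (by omega), if_neg, if_neg]
    · rintro ⟨rfl, -⟩; omega
    · rintro ⟨rfl, -⟩; omega
  obtain ⟨k, i⟩ := a
  obtain ⟨l, j⟩ := b
  obtain ⟨hk, hi⟩ := mem_semidefIndex.1 ha
  obtain ⟨hl, hj⟩ := mem_semidefIndex.1 hb
  simp only at hab hk hi hl hj ⊢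
  have hl' := (sturmDen_succ_leading hdeg l (by omega)).2
  have hk' := (sturmDen_succ_leading hdeg k (by omega)).2
  have hQl := sturmDen_ne_zero hdeg (show l ≤ sturmLength f₀ f₁ by omega)
  have hQk := sturmDen_ne_zero hdeg (show k ≤ sturmLength f₀ f₁ by omega)
  have hnd : (X ^ (i + j) * sturmDen f₀ f₁ k).natDegree =
      i + j + (sturmDen f₀ f₁ k).natDegree := by
    rw [natDegree_mul (pow_ne_zero _ X_ne_zero) hQk, natDegree_X_pow]
  rw [show shiftedDen f₀ f₁ ⟨k, i⟩ * shiftedDen f₀ f₁ ⟨l, j⟩ =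
    X ^ (i + j) * sturmDen f₀ f₁ k * sturmDen f₀ f₁ l by simp only [shiftedDen]; ring]
  split_ifs with h
  · obtain ⟨h, hm⟩ := h
    obtain ⟨rfl, h'⟩ := Sigma.mk.inj_iff.1 h
    obtain rfl := eq_of_heq h'
    rw [polyMoment_mul_sturmDen_eq_div hdeg (by omega) (by omega), hk'.2, leadingCoeff_mul,
      leadingCoeff_X_pow, one_mul, div_mul_cancel_right₀ (leadingCoeff_ne_zero.2 hQk)]
  · -- It remains to check `i + j + deg Q_k + 1 < deg Q_{l+1}`, separately for `k = l` and `k < l`.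
    refine polyMoment_mul_sturmDen_eq_zero hdeg (by omega) ?_
    rw [hnd]
    rcases hab.eq_or_lt with rfl | hlt
    · have : ¬ (i = j ∧ 2 * i + 1 = (sturmQuot f₀ f₁ k).natDegree) := by
        rintro ⟨rfl, h'⟩
        exact h ⟨rfl, h'⟩
      omega
    · have := natDegree_sturmDen_mono hdeg (show k + 1 ≤ l by omega) (by omega)
      omega

lemma linearIndependent_coeffVec_shiftedDen {n : ℕ} (hdeg : f₁.degree < f₀.degree) {t : ℕ}
    (ht : t < sturmLength f₀ f₁) (hn : (sturmDen f₀ f₁ (t + 1)).natDegree = n)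
    (S : ℝ → Prop) [DecidablePred S] :
    LinearIndependent ℝ fun a : semidefIndex f₀ f₁ t S => coeffVec n (shiftedDen f₀ f₁ a) := by
  have hmem (a : semidefIndex f₀ f₁ t S) : a.1.1 ≤ t := (mem_semidefIndex.1 a.2).1
  have hle (a : semidefIndex f₀ f₁ t S) : a.1.1 ≤ sturmLength f₀ f₁ := (hmem a).trans ht.le
  refine linearIndependent_coeffVec (fun a => hn ▸ degree_shiftedDen_lt hdeg ht a.2)
    (linearIndependent_of_natDegree_injective (fun a => shiftedDen_ne_zero hdeg (hle a))
      fun a b hab => ?_)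
  have ha := natDegree_shiftedDen hdeg (hle a)
  have hb := natDegree_shiftedDen hdeg (hle b)
  have ha' := natDegree_shiftedDen_lt hdeg ht a.2
  have hb' := natDegree_shiftedDen_lt hdeg ht b.2
  simp only at hab
  -- The degrees of `x ^ j * Q_k`, `j < m_k`, lie between those of `Q_k` and of `Q_{k+1}`.
  rcases lt_trichotomy a.1.1 b.1.1 with h | h | h
  · have := natDegree_sturmDen_mono hdeg (show a.1.1 + 1 ≤ b.1.1 by omega) (hle b)
    omega
  · rw [h] at ha
    exact Subtype.ext (Sigma.ext h (heq_of_eq (by omega)))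
  · have := natDegree_sturmDen_mono hdeg (show b.1.1 + 1 ≤ a.1.1 by omega) (hle a)
    omega

/-- The signature counts the middle vectors of the blocks of odd size `m_k`, with the sign of
`b_k`. -/
lemma matrixSignature_hankelMatrix {n : ℕ} {h : PowerSeries ℝ} (hdeg : f₁.degree < f₀.degree)
    (hH : (hankelMatrix n h).det ≠ 0)
    (hψ : ∀ k < 2 * n - 1, polyMoment f₀ f₁ (X ^ k) = PowerSeries.coeff k h) {t : ℕ}
    (ht : t < sturmLength f₀ f₁) (hn : (sturmDen f₀ f₁ (t + 1)).natDegree = n) :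
    matrixSignature (hankelMatrix n h) =
      ∑ i ∈ (Finset.range (t + 1)).filter (fun i => Odd (sturmQuot f₀ f₁ i).natDegree),
        (SignType.sign (sturmQuot f₀ f₁ i).leadingCoeff : ℤ) := by
  classical
  have hform {S : ℝ → Prop} [DecidablePred S] {a b : (_ : ℕ) × ℕ}
      (ha : a ∈ semidefIndex f₀ f₁ t S) (hb : b ∈ semidefIndex f₀ f₁ t S) :
      coeffVec n (shiftedDen f₀ f₁ a) ⬝ᵥ
        (hankelMatrix n h).mulVec (coeffVec n (shiftedDen f₀ f₁ b)) =
      if a = b ∧ 2 * a.2 + 1 = (sturmQuot f₀ f₁ a.1).natDegree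
        then (sturmQuot f₀ f₁ a.1).leadingCoeff⁻¹ else 0 := by
    rw [dotProduct_hankelMatrix_mulVec hψ (hn ▸ degree_shiftedDen_lt hdeg ht ha)
      (hn ▸ degree_shiftedDen_lt hdeg ht hb), polyMoment_shiftedDen_mul hdeg ht ha hb]
  have hsgn : ∀ k ∈ Finset.range (t + 1), (sturmQuot f₀ f₁ k).leadingCoeff ≠ 0 := fun k hk =>
    leadingCoeff_ne_zero.2 (sturmQuot_ne_zero hdeg (by have := Finset.mem_range.1 hk; omega))
  rw [matrixSignature_eq_card_sub_card (hankelMatrix_isSymm n h) hH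
    (e := fun a => coeffVec n (shiftedDen f₀ f₁ a))
    (P := semidefIndex f₀ f₁ t (0 < ·)) (N := semidefIndex f₀ f₁ t (· < 0))
    (linearIndependent_coeffVec_shiftedDen hdeg ht hn _)
    (linearIndependent_coeffVec_shiftedDen hdeg ht hn _)]
  · rw [card_semidefIndex, card_semidefIndex, Finset.sum_filter]
    push_cast
    rw [← Finset.sum_sub_distrib]
    refine Finset.sum_congr rfl fun k hk => ?_
    rcases (hsgn k hk).lt_or_gt with hb | hb
    · simp only [hb, hb.not_gt, and_true, and_false, if_false, sign_neg hb]
      split_ifs <;> simp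
    · simp only [hb, hb.not_gt, and_true, and_false, if_false, sign_pos hb]
      split_ifs <;> simp
  · rw [card_semidefIndex, card_semidefIndex, ← Finset.sum_add_distrib, ← hn,
      natDegree_sturmDen hdeg _ ht]
    refine Finset.sum_congr rfl fun k hk => ?_
    rcases (hsgn k hk).lt_or_gt with hb | hb <;>
    · simp only [hb, hb.not_gt, and_true, and_false, if_false, Nat.odd_iff]
      split_ifs <;> omega
  · intro a ha b hb hab
    rw [hform ha hb, if_neg fun h => hab h.1]
  · intro a ha b hb hab
    rw [hform ha hb, if_neg fun h => hab h.1]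
  · intro a ha
    rw [hform ha ha]
    split_ifs with h
    · have := (mem_semidefIndex.1 ha).2
      exact inv_nonneg.2 (this.resolve_left (by omega)).2.le
    · exact le_rfl
  · intro a ha
    rw [hform ha ha]
    split_ifs with h
    · have := (mem_semidefIndex.1 ha).2
      exact inv_nonpos.2 (this.resolve_left (by omega)).2.le
    · exact le_rfl

end Sturm

/-! ### Sign changes at infinity -/

lemma signChanges_append_zero (l : List ℝ) : signChanges (l ++ [0]) = signChanges l := by
  simp [signChanges, List.filter_append]

lemma signChanges_cons_cons {x y : ℝ} {l : List ℝ} (hx : x ≠ 0) (hy : y ≠ 0) :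
    signChanges (x :: y :: l) = signChanges (y :: l) + if x * y < 0 then 1 else 0 := by
  simp [signChanges, hx, hy, List.countP_cons]

/-- Without zeros, sign changes are the neighbours with negative product. -/
lemma signChanges_map_range (k : ℕ) : ∀ a : ℕ → ℝ, (∀ i ≤ k, a i ≠ 0) →
    signChanges ((List.range (k + 1)).map a) =
      ∑ i ∈ Finset.range k, if a i * a (i + 1) < 0 then 1 else 0 := by
  induction k with
  | zero =>
    intro a h
    simp [signChanges, h 0 le_rfl]
  | succ k ih =>
    intro a h
    rw [Finset.sum_range_succ', ← ih (fun i => a (i + 1)) fun i hi => h (i + 1) (by omega),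
      List.range_succ_eq_map, List.map_cons, List.map_map, List.range_succ_eq_map, List.map_cons,
      List.map_cons]
    exact signChanges_cons_cons (h 0 (by omega)) (h 1 (by omega))

lemma eventually_atTop_eval_mul_leadingCoeff_pos {p : ℝ[X]} (hp : p ≠ 0) :
    ∀ᶠ x in atTop, 0 < p.eval x * p.leadingCoeff := by
  have hlc := leadingCoeff_ne_zero.2 hp
  have h := div_tendsto_atTop_leadingCoeff_div_of_degree_eq p (X ^ p.natDegree)
    (by rw [degree_X_pow, degree_eq_natDegree hp])
  rw [leadingCoeff_X_pow, div_one] at h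
  have h2 := (h.mul_const p.leadingCoeff).eventually (lt_mem_nhds (mul_self_pos.2 hlc))
  filter_upwards [h2, eventually_gt_atTop 0] with x hx hx0
  rw [eval_pow, eval_X, div_mul_eq_mul_div] at hx
  exact (div_pos_iff_of_pos_right (pow_pos hx0 _)).1 hx

lemma eventually_atBot_eval_mul_leadingCoeff_pos {p : ℝ[X]} (hp : p ≠ 0) :
    ∀ᶠ x in atBot, 0 < p.eval x * ((-1) ^ p.natDegree * p.leadingCoeff) := by
  have hne : p.comp (-X) ≠ 0 := by
    intro h
    have := congrArg (fun q => q.comp (-X)) h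
    simp [comp_assoc] at this
    exact hp this
  have h := tendsto_neg_atBot_atTop.eventually (eventually_atTop_eval_mul_leadingCoeff_pos hne)
  filter_upwards [h] with x hx
  rw [eval_comp, leadingCoeff_comp (by simp)] at hx
  simpa [mul_comm] using hx

section Sturm

variable {f₀ f₁ : ℝ[X]}

/-- At either end of the line (`ε = 1` for `+∞` and `ε = -1` for `-∞`), the pair `f_i, f_{i+1}`
eventually has a sign change exactly when the leading term of `B_i` is negative there. -/
lemma eventually_sturmVar_eq (hdeg : f₁.degree < f₀.degree) {k : ℕ} (hk : k ≤ sturmLength f₀ f₁)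
    {l : Filter ℝ} {ε : ℝ} (h : ∀ p : ℝ[X], p ≠ 0 →
      ∀ᶠ x in l, 0 < p.eval x * (ε ^ p.natDegree * p.leadingCoeff)) :
    ∀ᶠ c in l, sturmVar f₀ f₁ k c = ∑ i ∈ Finset.range k,
      if ε ^ (sturmQuot f₀ f₁ i).natDegree * (sturmQuot f₀ f₁ i).leadingCoeff < 0
        then 1 else 0 := by
  have h : ∀ᶠ c in l, ∀ i ∈ Finset.range (k + 1), 0 < (sturmSeq f₀ f₁ i).eval c *
      (ε ^ (sturmSeq f₀ f₁ i).natDegree * (sturmSeq f₀ f₁ i).leadingCoeff) :=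
    (eventually_all_finset _).2 fun i hi => h _
      (sturmSeq_ne_zero hdeg (by have := Finset.mem_range.1 hi; omega))
  filter_upwards [h] with c hc
  have hc' (i : ℕ) (hi : i ≤ k) := hc i (Finset.mem_range.2 (by omega))
  rw [sturmVar, signChanges_map_range k _ fun i hi => left_ne_zero_of_mul (hc' i hi).ne']
  refine Finset.sum_congr rfl fun i hi => ?_
  have hi' := Finset.mem_range.1 hi
  have h0 := hc' i (by omega)
  have h1 := hc' (i + 1) (by omega)
  rw [← leadingCoeff_sturmQuot_mul hdeg (by omega : i < sturmLength f₀ f₁),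
    ← natDegree_sturmQuot_add hdeg (by omega : i < sturmLength f₀ f₁), pow_add] at h0
  -- The values have the signs of the leading terms `B_i g` and `g` of `f_i` and `f_{i+1}`, so the
  -- product of the values has the sign of `B_i`, as `g * g` is a square.
  have key := pos_of_mul_pos_left ((mul_pos h0 h1).trans_eq (show _ =
    ((sturmSeq f₀ f₁ i).eval c * (sturmSeq f₀ f₁ (i + 1)).eval c *
      (ε ^ (sturmQuot f₀ f₁ i).natDegree * (sturmQuot f₀ f₁ i).leadingCoeff)) *
    ((ε ^ (sturmSeq f₀ f₁ (i + 1)).natDegree * (sturmSeq f₀ f₁ (i + 1)).leadingCoeff) *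
      (ε ^ (sturmSeq f₀ f₁ (i + 1)).natDegree * (sturmSeq f₀ f₁ (i + 1)).leadingCoeff)) by ring))
    (mul_self_nonneg _)
  simp only [neg_iff_neg_of_mul_pos key]

lemma eventually_atTop_sturmVar_eq (hdeg : f₁.degree < f₀.degree) {k : ℕ}
    (hk : k ≤ sturmLength f₀ f₁) :
    ∀ᶠ c in atTop, sturmVar f₀ f₁ k c =
      ∑ i ∈ Finset.range k, if (sturmQuot f₀ f₁ i).leadingCoeff < 0 then 1 else 0 := by
  have h := eventually_sturmVar_eq hdeg hk (l := atTop) (ε := 1) fun p hp => by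
    simpa only [one_pow, one_mul] using eventually_atTop_eval_mul_leadingCoeff_pos hp
  simpa only [one_pow, one_mul] using h

lemma eventually_atBot_sturmVar_eq (hdeg : f₁.degree < f₀.degree) {k : ℕ}
    (hk : k ≤ sturmLength f₀ f₁) :
    ∀ᶠ c in atBot, sturmVar f₀ f₁ k c = ∑ i ∈ Finset.range k,
      if (-1) ^ (sturmQuot f₀ f₁ i).natDegree * (sturmQuot f₀ f₁ i).leadingCoeff < 0
        then 1 else 0 :=
  eventually_sturmVar_eq hdeg hk fun _ hp =>
    eventually_atBot_eval_mul_leadingCoeff_pos hp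

lemma sturmVar_sturmLength_succ (f₀ f₁ : ℝ[X]) (c : ℝ) :
    sturmVar f₀ f₁ (sturmLength f₀ f₁ + 1) c = sturmVar f₀ f₁ (sturmLength f₀ f₁) c := by
  rw [sturmVar, List.range_succ, List.map_append, List.map_singleton, sturmSeq_sturmLength_succ,
    eval_zero, signChanges_append_zero, sturmVar]

lemma ite_neg_one_pow_mul_sub_ite {m : ℕ} {b : ℝ} (hb : b ≠ 0) :
    ((if (-1) ^ m * b < 0 then 1 else 0 : ℕ) : ℤ) - ((if b < 0 then 1 else 0 : ℕ) : ℤ) =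
      if Odd m then (SignType.sign b : ℤ) else 0 := by
  rcases m.even_or_odd with hm | hm
  · simp [hm.neg_one_pow, Nat.not_odd_iff_even.2 hm]
  · rcases hb.lt_or_gt with h | h
    · simp [hm.neg_one_pow, hm, h, h.not_gt]
    · simp [hm.neg_one_pow, hm, h, h.not_gt]

end Sturm

theorem mainTheorem3 (n : ℕ) (hn : 1 ≤ n) (h : PowerSeries ℝ) (f₀ f₁ : ℝ[X])
    (hdeg : f₁.degree < f₀.degree)
    (hH : (hankelMatrix n h).det ≠ 0)
    (hS : PowerSeries.trunc (2 * n - 1) (sturmSeries f₀ f₁) = PowerSeries.trunc (2 * n - 1) h) :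
    ∃ t : ℕ, t < sturmLength f₀ f₁ ∧
      ∑ i ∈ Finset.range (t + 1), (sturmQuot f₀ f₁ i).natDegree = n ∧
      -- the limits of `V` on `f_0, …, f_{t+1}`
      ∃ vneg vpos : ℕ,
        Tendsto (sturmVar f₀ f₁ (t + 1)) atBot (𝓝 vneg) ∧
        Tendsto (sturmVar f₀ f₁ (t + 1)) atTop (𝓝 vpos) ∧
        -- if `t = s - 1`, these are the limits of `V` on the whole sequence `f_0, …, f_{s+1}`
        (t + 1 = sturmLength f₀ f₁ →
          Tendsto (sturmVar f₀ f₁ (sturmLength f₀ f₁ + 1)) atBot (𝓝 vneg) ∧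
          Tendsto (sturmVar f₀ f₁ (sturmLength f₀ f₁ + 1)) atTop (𝓝 vpos)) ∧
        matrixSignature (hankelMatrix n h) = (vneg : ℤ) - (vpos : ℤ) ∧
        matrixSignature (hankelMatrix n h) =
          ∑ i ∈ (Finset.range (t + 1)).filter (fun i => Odd (sturmQuot f₀ f₁ i).natDegree),
            (SignType.sign (sturmQuot f₀ f₁ i).leadingCoeff : ℤ) := by
  have hψ : ∀ k < 2 * n - 1, polyMoment f₀ f₁ (X ^ k) = PowerSeries.coeff k h := by
    intro k hk
    have h1 := congrArg (fun p => p.coeff k) hS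
    simp only [PowerSeries.coeff_trunc, if_pos hk] at h1
    rw [polyMoment_apply, ← coeff_sturmSeries hdeg, h1]
  obtain ⟨t, ht, htn⟩ := exists_natDegree_sturmDen_eq hn hdeg hH hψ
  have hsig := matrixSignature_hankelMatrix hdeg hH hψ ht htn
  have hbot := tendsto_nhds_of_eventually_eq (eventually_atBot_sturmVar_eq hdeg (k := t + 1) ht)
  have htop := tendsto_nhds_of_eventually_eq (eventually_atTop_sturmVar_eq hdeg (k := t + 1) ht)
  refine ⟨t, ht, by rw [← natDegree_sturmDen hdeg _ ht, htn], _, _, hbot, htop, ?_, ?_, hsig⟩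
  · intro hs
    rw [funext (sturmVar_sturmLength_succ f₀ f₁), ← hs]
    exact ⟨hbot, htop⟩
  · rw [hsig, Finset.sum_filter, Nat.cast_sum, Nat.cast_sum, ← Finset.sum_sub_distrib]
    refine Finset.sum_congr rfl fun i hi => ?_
    have hb : (sturmQuot f₀ f₁ i).leadingCoeff ≠ 0 := leadingCoeff_ne_zero.2
      (sturmQuot_ne_zero hdeg (by have := Finset.mem_range.1 hi; omega))
    exact (ite_neg_one_pow_mul_sub_ite hb).symm
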